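/- **Model.** There are $N$ agents, ranked $1,\dots,N$, and $K\ge N$ arms. In each round $t=1,2,\dots$ every agent $i$ chooses an arm $I^{(i)}(t)$. Agent $i$ is matched in round $t$ if no higher ranked agent (one of $1,\dots,i-1$) chooses the same arm; otherwise it is blocked, which it is told, and its reward is $0$. An agent $i$ matched with arm $k$ receives a Bernoulli reward of mean $\mu_{ik}\in(0,1)$, independent of all other rewards. For each agent $i$ the means $(\mu_{ik})_{k}$ are pairwise distinct. An instance is the collection $\nu=(\mu_{ik})$. Its unique stable matching gives agent $i$ the arm $k_*^{(i)}=\arg\max_{k\notin\{k_*^{(1)},\dots,k_*^{(i-1)}\}}\mu_{ik}$. The instance is *optimally stable* (OSB) if $\mu_{ik}<\mu_{ik_*^{(i)}}$ for all $i$ and all $k\ne k_*^{(i)}$, and its minimum gap is the smallest value of $\mu_{ik_*^{(i)}}-\mu_{ik}$ over all agents $i$ and all arms $k\notin\{k_*^{(1)},\dots,k_*^{(i)}\}$. A policy gives, for each $t$, the (joint) distribution of the arms chosen in round $t+1$ as a function of the choices, rewards and blockings of rounds $1,\dots,t$; this includes all decentralized policies, in which each agent uses its own observations only. The regret of agent $i$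 is $R_T^{(i)}(\nu,\pi)=\sum_{t=1}^T\mathbb E_{\nu,\pi}\big[\mu_{ik_*^{(i)}}-\mu_{iI^{(i)}(t)}\mathbf 1\{i\text{ is matched in round }t\}\big]$. A policy $\pi$ is *uniformly consistent* if $\limsup_{T\to\infty}R_T^{(i)}(\nu,\pi)/T^\alpha\le 0$ for every instance $\nu$ (with $N$ agents and $K$ arms), every agent $i$ and every $\alpha\in(0,1)$. **Statement.** There is a universal constant $c>0$ such that for all $K\ge 2$, all $N\le K$, all $j\in\{1,\dots,N\}$ and all $\Delta\in(0,1/4]$ there is an OSB instance $\nu$ with $N$ agents, $K$ arms, Bernoulli rewards and minimum gap $\Delta$ on which every uniformly consistent policy $\pi$ satisfies, for all sufficiently large $T$ (depending on $\nu$ and $\pi$), $$R_T^{(j)}(\nu,\pi)\;\ge\; c\,\max\Big\{\frac{(j-1)\log T}{\Delta^2},\ \frac{K\log T}{\Delta}\Big\}.$$ -/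

import Mathlib

namespace SerialDictatorship

/-- An instance of the serial-dictatorship bandit with Bernoulli rewards: `N` agents, `K ≥ N` arms,
and for agent `j` and arm `k` the mean `mean j k ∈ (0, 1)` of the Bernoulli reward that `j` gets
when matched with `k`; each agent has pairwise distinct arm means.
Agents are indexed by `Fin N` in the order of their ranks, starting from `0`: `i < j` means that
`i` is ranked higher than `j`, and the agent of rank `r` in `{1, …, N}` has index `r - 1`. -/
structure BernoulliInstance (N K : ℕ) where
  mean : Fin N → Fin K → ℝ
  agents_le_arms : N ≤ K
  mean_pos : ∀ j k, 0 < mean j k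
  mean_lt_one : ∀ j k, mean j k < 1
  mean_injective : ∀ j, Function.Injective (mean j)

namespace BernoulliInstance

variable {N K : ℕ}

/-- `m` matches agents to distinct arms, and there is no blocking pair: if agent `j` strictly
prefers arm `k` to its partner `m j`, then `k` is matched to an agent ranked higher than `j`. -/
def IsStableMatching (ν : BernoulliInstance N K) (m : Fin N → Fin K) : Prop :=
  Function.Injective m ∧ ∀ j k, ν.mean j (m j) < ν.mean j k → ∃ i, i < j ∧ m i = k

theorem existsUnique_isStableMatching (ν : BernoulliInstance N K) :
    ∃! m : Fin N → Fin K, ν.IsStableMatching m := by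
  classical
  have key : ∀ n : ℕ, n ≤ N → ∃ m : Fin N → Fin K,
      (∀ i j : Fin N, i.1 < n → j.1 < n → m i = m j → i = j) ∧
      ∀ j : Fin N, j.1 < n → ∀ k, ν.mean j (m j) < ν.mean j k → ∃ i, i < j ∧ m i = k := by
    intro n
    induction n with
    | zero =>
      intro _
      exact ⟨fun i => Fin.castLE ν.agents_le_arms i, by simp, by simp⟩
    | succ n ih =>
      intro hn
      obtain ⟨m, hm1, hm2⟩ := ih (by omega)
      let a : Fin N := ⟨n, hn⟩
      let used : Finset (Fin K) := (Finset.univ.filter fun i : Fin N => i < a).image m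
      have hcard : used.card < K := by
        calc used.card ≤ (Finset.univ.filter fun i : Fin N => i < a).card := Finset.card_image_le
          _ < (Finset.univ : Finset (Fin N)).card :=
            Finset.card_lt_card (Finset.filter_ssubset.2 ⟨a, by simp, by simp⟩)
          _ = N := by simp
          _ ≤ K := ν.agents_le_arms
      have hne : (usedᶜ).Nonempty := by
        rw [← Finset.card_pos, Finset.card_compl, Fintype.card_fin]
        omega
      obtain ⟨b, hb, hmax⟩ := Finset.exists_max_image usedᶜ (ν.mean a) hne
      have hb' : ∀ i : Fin N, i.1 < n → m i ≠ b := by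
        intro i hi h
        apply Finset.mem_compl.1 hb
        exact Finset.mem_image.2 ⟨i, by simpa [a, Fin.lt_def] using hi, h⟩
      have hupd : ∀ i : Fin N, i.1 < n → Function.update m a b i = m i := by
        intro i hi
        refine Function.update_of_ne ?_ _ _
        rintro rfl
        exact lt_irrefl _ hi
      have hcases : ∀ i : Fin N, i.1 < n + 1 → i.1 < n ∨ i = a := by
        intro i hi
        rcases Nat.lt_succ_iff_lt_or_eq.1 hi with h | h
        · exact Or.inl h
        · exact Or.inr (Fin.ext h)
      refine ⟨Function.update m a b, ?_, ?_⟩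
      · intro i j hi hj hij
        rcases hcases i hi with hi | rfl <;> rcases hcases j hj with hj | rfl
        · rw [hupd i hi, hupd j hj] at hij
          exact hm1 i j hi hj hij
        · rw [hupd i hi, Function.update_self] at hij
          exact absurd hij (hb' i hi)
        · rw [hupd j hj, Function.update_self] at hij
          exact absurd hij.symm (hb' j hj)
        · rfl
      · intro j hj k hk
        rcases hcases j hj with hj | rfl
        · rw [hupd j hj] at hk
          obtain ⟨i, hi, hik⟩ := hm2 j hj k hk
          exact ⟨i, hi, by rw [hupd i (lt_trans hi hj), hik]⟩
        · rw [Function.update_self] at hk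
          have hku : k ∈ used := by
            by_contra hcon
            exact absurd (hmax k (Finset.mem_compl.2 hcon)) (not_le.2 hk)
          obtain ⟨i, hi, hik⟩ := Finset.mem_image.1 hku
          have hi' : i < a := (Finset.mem_filter.1 hi).2
          exact ⟨i, hi', by rw [hupd i hi', hik]⟩
  obtain ⟨m, hm1, hm2⟩ := key N le_rfl
  have hm : ν.IsStableMatching m :=
    ⟨fun i j h => hm1 i j i.2 j.2 h, fun j k h => hm2 j j.2 k h⟩
  refine ⟨m, hm, ?_⟩
  intro m' hm'
  have hagree : ∀ n : ℕ, ∀ j : Fin N, j.1 = n → m' j = m j := by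
    intro n
    induction n using Nat.strong_induction_on with
    | _ n ih =>
      intro j hj
      apply ν.mean_injective j
      apply le_antisymm
      · by_contra hcon
        obtain ⟨i, hi, hik⟩ := hm.2 j (m' j) (not_le.1 hcon)
        rw [← ih i.1 (hj ▸ hi) i rfl] at hik
        exact absurd (hm'.1 hik) hi.ne
      · by_contra hcon
        obtain ⟨i, hi, hik⟩ := hm'.2 j (m j) (not_le.1 hcon)
        rw [ih i.1 (hj ▸ hi) i rfl] at hik
        exact absurd (hm.1 hik) hi.ne
  exact funext fun j => hagree j.1 j rfl

/-- The partner of agent `j` in the unique stable matching. -/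
noncomputable def stableArm (ν : BernoulliInstance N K) : Fin N → Fin K :=
  ν.existsUnique_isStableMatching.choose

theorem isStableMatching_stableArm (ν : BernoulliInstance N K) :
    ν.IsStableMatching ν.stableArm :=
  ν.existsUnique_isStableMatching.choose_spec.1

/-- Optimally stable bandit: the stable partner of each agent is its best arm among all arms. -/
def IsOSB (ν : BernoulliInstance N K) : Prop :=
  ∀ j k, k ≠ ν.stableArm j → ν.mean j k < ν.mean j (ν.stableArm j)

/-- The gap of arm `k` for agent `j`. -/
noncomputable def gap (ν : BernoulliInstance N K) (j : Fin N) (k : Fin K) : ℝ :=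
  ν.mean j (ν.stableArm j) - ν.mean j k

/-- `Δ` is the smallest gap, over all agents `j` and all arms `k` that are not the stable partner
of `j` or of an agent ranked higher than `j`. -/
def IsMinGap (ν : BernoulliInstance N K) (Δ : ℝ) : Prop :=
  IsLeast {δ | ∃ (j : Fin N) (k : Fin K), (∀ i ≤ j, ν.stableArm i ≠ k) ∧ δ = ν.gap j k} Δ

end BernoulliInstance

/-- What happens in one round: the arm chosen by each agent, and the feedback of each agent, which
is `none` if the agent is blocked and otherwise its Bernoulli reward. -/
abbrev Round (N K : ℕ) : Type := (Fin N → Fin K) × (Fin N → Option Bool)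

/-- A policy (with internal randomization): given the first `t` rounds, the joint distribution of
the arms that the agents choose in the next round. Arbitrary coordination is allowed, so this
contains all decentralized policies, in which each agent uses its own past only. -/
abbrev Policy (N K : ℕ) : Type :=
  (t : ℕ) → (Fin t → Round N K) → stdSimplex ℝ (Fin N → Fin K)

/-- Agent `j` is matched (to `a j`) iff no higher ranked agent chooses the same arm. -/
def Matched {N K : ℕ} (a : Fin N → Fin K) (j : Fin N) : Prop :=
  ∀ i < j, a i ≠ a j

/-- Probability of the feedback of an agent that is matched to an arm of mean `p`. -/
def rewardProb (p : ℝ) : Option Bool → ℝ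
  | none => 0
  | some true => p
  | some false => 1 - p

open Classical in
/-- Conditional probability of the feedbacks `x` of all agents when they choose the arms `a`:
matched agents get independent rewards, the other agents are blocked. -/
noncomputable def feedbackProb {N K : ℕ} (ν : BernoulliInstance N K) (a : Fin N → Fin K)
    (x : Fin N → Option Bool) : ℝ :=
  ∏ j, if Matched a j then rewardProb (ν.mean j (a j)) (x j) else if x j = none then 1 else 0

/-- Probability that the first `t` rounds are `h` under the instance `ν` and the policy `π`. -/
noncomputable def historyProb {N K : ℕ} (ν : BernoulliInstance N K) (π : Policy N K) :
    (t : ℕ) → (Fin t → Round N K) → ℝ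
  | 0, _ => 1
  | t + 1, h =>
    historyProb ν π t (fun s => h s.castSucc) *
      ((π t (fun s => h s.castSucc)).1 (h (Fin.last t)).1 *
        feedbackProb ν (h (Fin.last t)).1 (h (Fin.last t)).2)

open Classical in
/-- Expected regret of agent `j` after `T` rounds, against its partner in the stable matching. -/
noncomputable def regret {N K : ℕ} (ν : BernoulliInstance N K) (π : Policy N K) (j : Fin N)
    (T : ℕ) : ℝ :=
  ∑ h : Fin T → Round N K, historyProb ν π T h *
    ∑ t : Fin T, (ν.mean j (ν.stableArm j) -
      if Matched (h t).1 j then ν.mean j ((h t).1 j) else 0)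

/-- Uniformly consistent policy: on every Bernoulli instance with `N` agents and `K` arms, the
regret of each agent has no positive part of the order of a power of `T`. -/
def UniformlyConsistent {N K : ℕ} (π : Policy N K) : Prop :=
  ∀ (ν : BernoulliInstance N K) (j : Fin N) (α : ℝ), 0 < α → α < 1 →
    Filter.limsup (fun T : ℕ => ((regret ν π j T / (T : ℝ) ^ α : ℝ) : EReal)) Filter.atTop ≤ 0

end SerialDictatorship

/-!
Under any two instances `ν`, `ν'` in which agent `i` has different stable partners, the histories
have a log-likelihood ratio whose mean is `∑ j k, kl(μ_jk, μ'_jk) 𝔼[N_jk]`, where `N_jk` counts the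
rounds in which `j` is matched to `k`. Testing which arm `i` is mostly matched to separates the two
instances if the regrets are small, so by the Bretagnolle–Huber inequality the mean
is asymptotically at least `(1 - α) log T` under a uniformly consistent policy. Raising a single
mean `μ_ik` above the best one hence shows that `i` is matched to `k` logarithmically often, for
each arm `k` that is not the stable partner of `i` or of a higher ranked agent.

If all gaps are of the order `Δ`, agent `j` itself explores each of its at least `K - j` such arms
of the order `log T / Δ ^ 2` times, at the cost `Δ` each time. If instead the gaps of agent `j` are
of constant order, it is blocked from its stable partner of the order `log T / Δ ^ 2` times by each
of the higher ranked agents, at constant cost. The first kind of instance is needed only when there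
are at most `K Δ ≤ K / 4` higher ranked agents, and then `K - j` is of the order `K`.
-/

namespace SerialDictatorship

open Filter Finset
open scoped Topology

section BretagnolleHuber

variable {ι : Type*} [Fintype ι] {p q : ι → ℝ}

theorem exp_neg_sum_mul_le_sq_sum (hp : ∀ i, 0 ≤ p i) (hp1 : ∑ i, p i = 1) (L : ι → ℝ) :
    Real.exp (-∑ i, p i * L i) ≤ (∑ i, p i * Real.exp (-L i / 2)) ^ 2 := by
  have jensen : Real.exp (∑ i, p i * (-L i / 2)) ≤ ∑ i, p i * Real.exp (-L i / 2) :=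
    convexOn_exp.map_sum_le (fun i _ => hp i) hp1 fun _ _ => Set.mem_univ _
  calc Real.exp (-∑ i, p i * L i)
      = Real.exp (∑ i, p i * (-L i / 2)) ^ 2 := by
        rw [← Real.exp_nat_mul, mul_sum, ← sum_neg_distrib]
        congr 1
        exact sum_congr rfl fun i _ => by push_cast; ring
    _ ≤ _ := by gcongr

theorem sq_sum_sqrt_mul_le_two_mul_sum_min (hp : ∀ i, 0 ≤ p i) (hq : ∀ i, 0 ≤ q i)
    (hp1 : ∑ i, p i = 1) (hq1 : ∑ i, q i = 1) :
    (∑ i, √(p i * q i)) ^ 2 ≤ 2 * ∑ i, min (p i) (q i) := by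
  have hmin : 0 ≤ ∑ i, min (p i) (q i) := sum_nonneg fun i _ => le_min (hp i) (hq i)
  have hmax : ∑ i, max (p i) (q i) ≤ 2 := by
    calc ∑ i, max (p i) (q i) ≤ ∑ i, (p i + q i) :=
          sum_le_sum fun i _ => max_le_add_of_nonneg (hp i) (hq i)
      _ = 2 := by rw [sum_add_distrib, hp1, hq1, one_add_one_eq_two]
  calc (∑ i, √(p i * q i)) ^ 2
      ≤ (∑ i, min (p i) (q i)) * ∑ i, max (p i) (q i) :=
        sum_sq_le_sum_mul_sum_of_sq_le_mul _ (fun i _ => le_min (hp i) (hq i))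
          (fun i _ => (hp i).trans (le_max_left _ _)) fun i _ => by
            rw [Real.sq_sqrt (mul_nonneg (hp i) (hq i)), min_mul_max]
    _ ≤ 2 * ∑ i, min (p i) (q i) := by
        rw [mul_comm]
        gcongr

theorem mul_sum_min_le_test_error {φ : ι → ℝ} {c : ℝ} (hφ : ∀ i, φ i ∈ Set.Icc 0 c) :
    c * ∑ i, min (p i) (q i) ≤ ∑ i, p i * φ i + ∑ i, q i * (c - φ i) := by
  rw [mul_sum, ← sum_add_distrib]
  refine sum_le_sum fun i _ => ?_
  have hp := mul_le_mul_of_nonneg_right (min_le_left (p i) (q i)) (hφ i).1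
  have hq := mul_le_mul_of_nonneg_right (min_le_right (p i) (q i)) (sub_nonneg.2 (hφ i).2)
  linarith

theorem bretagnolle_huber {L φ : ι → ℝ} {c : ℝ} (hp : ∀ i, 0 ≤ p i) (hp1 : ∑ i, p i = 1)
    (hq1 : ∑ i, q i = 1) (hpq : ∀ i, q i = p i * Real.exp (-L i))
    (hφ : ∀ i, φ i ∈ Set.Icc 0 c) :
    c * (Real.exp (-∑ i, p i * L i) / 2) ≤ ∑ i, p i * φ i + ∑ i, q i * (c - φ i) := by
  have hc : 0 ≤ c := by
    simpa only [← sum_mul, hp1, one_mul] using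
      sum_nonneg fun i (_ : i ∈ univ) => mul_nonneg (hp i) ((hφ i).1.trans (hφ i).2)
  have hq : ∀ i, 0 ≤ q i := fun i => hpq i ▸ mul_nonneg (hp i) (Real.exp_pos _).le
  have hsqrt : ∀ i, √(p i * q i) = p i * Real.exp (-L i / 2) := fun i => by
    have hsq : p i * q i = (p i * Real.exp (-L i / 2)) ^ 2 := by
      rw [hpq, mul_pow, ← Real.exp_nat_mul]
      push_cast
      rw [mul_div_cancel₀ _ two_ne_zero]
      ring
    rw [hsq, Real.sqrt_sq (mul_nonneg (hp i) (Real.exp_pos _).le)]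
  have hmin : Real.exp (-∑ i, p i * L i) ≤ 2 * ∑ i, min (p i) (q i) := by
    refine (exp_neg_sum_mul_le_sq_sum hp hp1 L).trans ?_
    simpa only [hsqrt] using sq_sum_sqrt_mul_le_two_mul_sum_min hp hq hp1 hq1
  calc c * (Real.exp (-∑ i, p i * L i) / 2) ≤ c * ∑ i, min (p i) (q i) := by gcongr; linarith
    _ ≤ _ := mul_sum_min_le_test_error hφ

end BretagnolleHuber

variable {N K : ℕ} {ν ν' : BernoulliInstance N K} {π : Policy N K} {i j : Fin N} {k : Fin K} {T : ℕ}

section Expectation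

open Classical in
/-- Probability of the feedback `x` of agent `j` when the agents choose the arms `a`; the feedbacks
of different agents are independent, so these are the factors of `feedbackProb`. -/
noncomputable def agentFeedbackProb (ν : BernoulliInstance N K) (a : Fin N → Fin K) (j : Fin N)
    (x : Option Bool) : ℝ :=
  if Matched a j then rewardProb (ν.mean j (a j)) x else if x = none then 1 else 0

theorem feedbackProb_eq_prod (ν : BernoulliInstance N K) (a : Fin N → Fin K)
    (x : Fin N → Option Bool) : feedbackProb ν a x = ∏ j, agentFeedbackProb ν a j (x j) := rfl

theorem agentFeedbackProb_nonneg (ν : BernoulliInstance N K) (a : Fin N → Fin K) (j : Fin N)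
    (x : Option Bool) : 0 ≤ agentFeedbackProb ν a j x := by
  have hpos := ν.mean_pos j (a j)
  have hlt := ν.mean_lt_one j (a j)
  unfold agentFeedbackProb
  split_ifs
  · rcases x with _ | _ | _ <;> simp only [rewardProb] <;> linarith
  · exact zero_le_one
  · exact le_rfl

theorem sum_agentFeedbackProb (ν : BernoulliInstance N K) (a : Fin N → Fin K) (j : Fin N) :
    ∑ x, agentFeedbackProb ν a j x = 1 := by
  unfold agentFeedbackProb
  split_ifs <;> simp [Fintype.sum_option, rewardProb]

theorem feedbackProb_nonneg (ν : BernoulliInstance N K) (a : Fin N → Fin K)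
    (x : Fin N → Option Bool) : 0 ≤ feedbackProb ν a x :=
  prod_nonneg fun j _ => agentFeedbackProb_nonneg ν a j (x j)

theorem sum_feedbackProb (ν : BernoulliInstance N K) (a : Fin N → Fin K) :
    ∑ x, feedbackProb ν a x = 1 := by
  simp only [feedbackProb_eq_prod, ← Fintype.prod_sum, sum_agentFeedbackProb, prod_const_one]

theorem sum_feedbackProb_mul_apply (ν : BernoulliInstance N K) (a : Fin N → Fin K) (i : Fin N)
    (f : Option Bool → ℝ) :
    ∑ x, feedbackProb ν a x * f (x i) = ∑ y, agentFeedbackProb ν a i y * f y := by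
  have hfactor : ∀ x : Fin N → Option Bool, feedbackProb ν a x * f (x i) =
      ∏ j, agentFeedbackProb ν a j (x j) * (if j = i then f (x j) else 1) := fun x => by
    rw [feedbackProb_eq_prod, prod_mul_distrib, prod_ite_eq' univ i, if_pos (mem_univ i)]
  simp_rw [hfactor]
  rw [← Fintype.prod_sum (fun j y => agentFeedbackProb ν a j y * (if j = i then f y else 1)),
    Fintype.prod_eq_single i fun j hj => by
      simp only [hj, if_false, mul_one, sum_agentFeedbackProb]]
  simp only [if_true]

/-- Conditional mean of the functional `f` of a round when the agents choose the arms `a`. -/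
noncomputable def feedbackMean (ν : BernoulliInstance N K) (f : Round N K → ℝ)
    (a : Fin N → Fin K) : ℝ :=
  ∑ x, feedbackProb ν a x * f (a, x)

theorem feedbackMean_of_fst (ν : BernoulliInstance N K) (f : (Fin N → Fin K) → ℝ)
    (a : Fin N → Fin K) : feedbackMean ν (fun r => f r.1) a = f a := by
  simp only [feedbackMean, ← sum_mul, sum_feedbackProb, one_mul]

theorem historyProb_nonneg (ν : BernoulliInstance N K) (π : Policy N K) (T : ℕ)
    (h : Fin T → Round N K) : 0 ≤ historyProb ν π T h := by
  induction T with
  | zero => exact zero_le_one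
  | succ T ih =>
    exact mul_nonneg (ih _) (mul_nonneg ((π T _).2.1 _) (feedbackProb_nonneg _ _ _))

/-- Expectation over the histories of length `T`, as a linear functional. -/
noncomputable def expectation (ν : BernoulliInstance N K) (π : Policy N K) (T : ℕ) :
    ((Fin T → Round N K) → ℝ) →ₗ[ℝ] ℝ :=
  Fintype.linearCombination ℝ (historyProb ν π T)

theorem expectation_apply (f : (Fin T → Round N K) → ℝ) :
    expectation ν π T f = ∑ h, historyProb ν π T h * f h := by
  simp only [expectation, Fintype.linearCombination_apply, smul_eq_mul, mul_comm]

theorem expectation_mono : Monotone (expectation ν π T) := fun f g hfg => by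
  simp only [expectation_apply]
  exact sum_le_sum fun h _ => mul_le_mul_of_nonneg_left (hfg h) (historyProb_nonneg ν π T h)

theorem expectation_succ (f : (Fin (T + 1) → Round N K) → ℝ) :
    expectation ν π (T + 1) f = expectation ν π T fun h =>
      ∑ a, (π T h).1 a * feedbackMean ν (fun r => f (Fin.snoc h r)) a := by
  simp only [expectation_apply, feedbackMean, mul_sum]
  rw [← (Fin.snocEquiv fun _ : Fin (T + 1) => Round N K).sum_comp, Fintype.sum_prod_type_right]
  refine sum_congr rfl fun h _ => ?_
  rw [Fintype.sum_prod_type]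
  refine sum_congr rfl fun a _ => sum_congr rfl fun x _ => ?_
  simp only [Fin.snocEquiv, Equiv.coe_fn_mk, historyProb, Fin.snoc_castSucc, Fin.snoc_last]
  ring

theorem expectation_const (c : ℝ) : (expectation ν π T fun _ => c) = c := by
  induction T with
  | zero => simp [expectation_apply, historyProb]
  | succ T ih =>
    simp only [expectation_succ, feedbackMean_of_fst ν fun _ => c, ← sum_mul, (π T _).2.2, one_mul,
      ih]

theorem sum_historyProb (ν : BernoulliInstance N K) (π : Policy N K) (T : ℕ) :
    ∑ h, historyProb ν π T h = 1 := by
  simpa only [expectation_apply, mul_one] using expectation_const (ν := ν) (π := π) (T := T) 1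

theorem expectation_succ_sum_rounds (f : Round N K → ℝ) :
    (expectation ν π (T + 1) fun h => ∑ t, f (h t)) =
      (expectation ν π T fun h => ∑ t, f (h t)) +
        expectation ν π T fun h => ∑ a, (π T h).1 a * feedbackMean ν f a := by
  rw [expectation_succ, ← map_add]
  congr 1
  funext h
  simp only [feedbackMean, Pi.add_apply, Fin.sum_univ_castSucc, Fin.snoc_castSucc, Fin.snoc_last,
    mul_add, sum_add_distrib, ← sum_mul, sum_feedbackProb, (π T _).2.2, one_mul]

theorem expectation_sum_rounds_eq_feedbackMean (f : Round N K → ℝ) :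
    (expectation ν π T fun h => ∑ t, f (h t)) =
      expectation ν π T fun h => ∑ t, feedbackMean ν f (h t).1 := by
  induction T with
  | zero => simp only [univ_eq_empty, sum_empty]
  | succ T ih =>
    rw [expectation_succ_sum_rounds, expectation_succ_sum_rounds fun r => feedbackMean ν f r.1, ih]
    simp only [feedbackMean_of_fst]

end Expectation

section MatchCount

open Classical in
/-- Indicator that agent `i` is matched to arm `k` when the agents choose the arms `a`. -/
noncomputable def matchedTo (i : Fin N) (k : Fin K) (a : Fin N → Fin K) : ℝ :=
  if Matched a i ∧ a i = k then 1 else 0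

/-- Number of rounds in which agent `i` is matched to arm `k`, as a real random variable. -/
noncomputable def matchCount (i : Fin N) (k : Fin K) (h : Fin T → Round N K) : ℝ :=
  ∑ t, matchedTo i k (h t).1

theorem matchedTo_nonneg (i : Fin N) (k : Fin K) (a : Fin N → Fin K) : 0 ≤ matchedTo i k a := by
  unfold matchedTo
  split_ifs <;> norm_num

theorem sum_arms_matchedTo_le_one (i : Fin N) (a : Fin N → Fin K) :
    ∑ k, matchedTo i k a ≤ 1 := by
  by_cases hm : Matched a i <;> simp [matchedTo, hm]

theorem sum_agents_matchedTo_le_one (k : Fin K) (a : Fin N → Fin K) :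
    ∑ i, matchedTo i k a ≤ 1 := by
  classical
  simp only [matchedTo, sum_boole, Nat.cast_le_one, card_le_one, mem_filter_univ]
  rintro i ⟨hi, rfl⟩ j ⟨hj, hji⟩
  exact le_antisymm (not_lt.1 fun h => hi j h hji) (not_lt.1 fun h => hj i h hji.symm)

theorem matchCount_nonneg (i : Fin N) (k : Fin K) (h : Fin T → Round N K) :
    0 ≤ matchCount i k h :=
  sum_nonneg fun _ _ => matchedTo_nonneg _ _ _

theorem matchCount_le (i : Fin N) (k : Fin K) (h : Fin T → Round N K) :
    matchCount i k h ≤ T := by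
  have hle : ∀ a : Fin N → Fin K, matchedTo i k a ≤ 1 := fun a =>
    (single_le_sum (fun k _ => matchedTo_nonneg i k a) (mem_univ k)).trans
      (sum_arms_matchedTo_le_one i a)
  simpa [matchCount] using sum_le_sum fun t (_ : t ∈ univ) => hle (h t).1

theorem expectation_matchCount_nonneg : 0 ≤ expectation ν π T (matchCount i k) := by
  simpa only [expectation_const] using expectation_mono (matchCount_nonneg i k)

theorem sum_expectation_matchCount_le {ι : Type*} [Fintype ι] {f : ι → Fin N} {l : ι → Fin K}
    (h : ∀ a, ∑ x, matchedTo (f x) (l x) a ≤ 1) :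
    ∑ x, expectation ν π T (matchCount (f x) (l x)) ≤ T := by
  have hle : ∑ x, matchCount (f x) (l x) ≤ fun _ : Fin T → Round N K => (T : ℝ) := fun y => by
    simp only [Finset.sum_apply, matchCount]
    rw [sum_comm]
    simpa using sum_le_sum fun t (_ : t ∈ univ) => h (y t).1
  rw [← map_sum]
  exact (expectation_mono hle).trans_eq (expectation_const _)

end MatchCount

section LikelihoodRatio

/-- Log-likelihood ratio of a feedback under the means `p` and `q`. Since `0 / 0 = 0` and
`Real.log 0 = 0`, it vanishes for the feedback `none`, so that blocked agents contribute nothing. -/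
noncomputable def rewardLLR (p q : ℝ) (y : Option Bool) : ℝ :=
  Real.log (rewardProb p y / rewardProb q y)

/-- Kullback–Leibler divergence of the Bernoulli distributions with means `p` and `q`. -/
noncomputable def bernoulliKL (p q : ℝ) : ℝ :=
  p * Real.log (p / q) + (1 - p) * Real.log ((1 - p) / (1 - q))

theorem bernoulliKL_self (p : ℝ) : bernoulliKL p p = 0 := by
  have hlog : ∀ x : ℝ, Real.log (x / x) = 0 := fun x => by
    rcases eq_or_ne x 0 with rfl | hx <;> simp [*]
  rw [bernoulliKL, hlog, hlog, mul_zero, mul_zero, add_zero]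

theorem bernoulliKL_le {p q : ℝ} (hp : p ∈ Set.Ioo 0 1) (hq : q ∈ Set.Ioo 0 1) :
    bernoulliKL p q ≤ (p - q) ^ 2 / (q * (1 - q)) := by
  have hp' : 0 < 1 - p := sub_pos.2 hp.2
  have hq' : 0 < 1 - q := sub_pos.2 hq.2
  calc bernoulliKL p q ≤ p * (p / q - 1) + (1 - p) * ((1 - p) / (1 - q) - 1) :=
        add_le_add
          (mul_le_mul_of_nonneg_left (Real.log_le_sub_one_of_pos (div_pos hp.1 hq.1)) hp.1.le)
          (mul_le_mul_of_nonneg_left (Real.log_le_sub_one_of_pos (div_pos hp' hq')) hp'.le)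
    _ = (p - q) ^ 2 / (q * (1 - q)) := by
        have := hq.1
        field_simp
        ring

theorem rewardProb_eq_mul_exp {p q : ℝ} (hp : p ∈ Set.Ioo 0 1) (hq : q ∈ Set.Ioo 0 1)
    (y : Option Bool) : rewardProb q y = rewardProb p y * Real.exp (-rewardLLR p q y) := by
  cases y with
  | none => simp [rewardProb]
  | some b =>
    have hpos : ∀ {r : ℝ}, r ∈ Set.Ioo 0 1 → 0 < rewardProb r (some b) := fun hr => by
      cases b
      · exact sub_pos.2 hr.2
      · exact hr.1
    rw [rewardLLR, ← Real.log_inv, inv_div, Real.exp_log (div_pos (hpos hq) (hpos hp)),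
      mul_div_cancel₀ _ (hpos hp).ne']

theorem BernoulliInstance.mean_mem_Ioo (ν : BernoulliInstance N K) (i : Fin N) (k : Fin K) :
    ν.mean i k ∈ Set.Ioo 0 1 :=
  ⟨ν.mean_pos i k, ν.mean_lt_one i k⟩

theorem agentFeedbackProb_eq_mul_exp (ν ν' : BernoulliInstance N K) (a : Fin N → Fin K)
    (j : Fin N) (y : Option Bool) :
    agentFeedbackProb ν' a j y = agentFeedbackProb ν a j y *
      Real.exp (-rewardLLR (ν.mean j (a j)) (ν'.mean j (a j)) y) := by
  unfold agentFeedbackProb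
  split_ifs with hm hy
  · exact rewardProb_eq_mul_exp (ν.mean_mem_Ioo _ _) (ν'.mean_mem_Ioo _ _) y
  · simp [hy, rewardLLR, rewardProb]
  · rw [zero_mul]

theorem sum_agentFeedbackProb_mul_rewardLLR (ν ν' : BernoulliInstance N K) (a : Fin N → Fin K)
    (j : Fin N) :
    ∑ y, agentFeedbackProb ν a j y * rewardLLR (ν.mean j (a j)) (ν'.mean j (a j)) y =
      ∑ k, bernoulliKL (ν.mean j k) (ν'.mean j k) * matchedTo j k a := by
  by_cases hm : Matched a j <;>
    simp [hm, agentFeedbackProb, matchedTo, rewardLLR, rewardProb, bernoulliKL, Fintype.sum_option]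

/-- Log-likelihood ratio of a round under the instances `ν` and `ν'`; the arms chosen contribute
nothing, since their conditional distribution depends on the policy only. -/
noncomputable def roundLLR (ν ν' : BernoulliInstance N K) (r : Round N K) : ℝ :=
  ∑ j, rewardLLR (ν.mean j (r.1 j)) (ν'.mean j (r.1 j)) (r.2 j)

theorem feedbackProb_eq_mul_exp (ν ν' : BernoulliInstance N K) (a : Fin N → Fin K)
    (x : Fin N → Option Bool) :
    feedbackProb ν' a x = feedbackProb ν a x * Real.exp (-roundLLR ν ν' (a, x)) := by
  rw [roundLLR, ← sum_neg_distrib, Real.exp_sum, feedbackProb_eq_prod, feedbackProb_eq_prod,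
    ← prod_mul_distrib]
  exact prod_congr rfl fun j _ => agentFeedbackProb_eq_mul_exp ν ν' a j (x j)

theorem historyProb_eq_mul_exp (ν ν' : BernoulliInstance N K) (π : Policy N K)
    (h : Fin T → Round N K) :
    historyProb ν' π T h = historyProb ν π T h * Real.exp (-∑ t, roundLLR ν ν' (h t)) := by
  induction T with
  | zero => simp [historyProb]
  | succ T ih =>
    rw [historyProb, historyProb, ih, Fin.sum_univ_castSucc, neg_add, Real.exp_add,
      feedbackProb_eq_mul_exp ν ν']
    ring

theorem feedbackMean_roundLLR (ν ν' : BernoulliInstance N K) (a : Fin N → Fin K) :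
    feedbackMean ν (roundLLR ν ν') a =
      ∑ j, ∑ k, bernoulliKL (ν.mean j k) (ν'.mean j k) * matchedTo j k a := by
  simp only [feedbackMean, roundLLR, mul_sum]
  rw [sum_comm]
  refine sum_congr rfl fun j _ => ?_
  rw [sum_feedbackProb_mul_apply ν a j, sum_agentFeedbackProb_mul_rewardLLR]

/-- Divergence of the distributions under `ν` and `ν'` of the first `T` rounds of the policy `π`,
defined by its decomposition over agents and arms. -/
noncomputable def historyKL (ν ν' : BernoulliInstance N K) (π : Policy N K) (T : ℕ) : ℝ :=
  ∑ j, ∑ k, bernoulliKL (ν.mean j k) (ν'.mean j k) * expectation ν π T (matchCount j k)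

theorem expectation_sum_roundLLR :
    (expectation ν π T fun h => ∑ t, roundLLR ν ν' (h t)) = historyKL ν ν' π T := by
  have hcount : (fun h : Fin T → Round N K => ∑ t, feedbackMean ν (roundLLR ν ν') (h t).1) =
      ∑ j, ∑ k, bernoulliKL (ν.mean j k) (ν'.mean j k) • matchCount j k := by
    funext h
    simp only [feedbackMean_roundLLR, Finset.sum_apply, Pi.smul_apply, smul_eq_mul, matchCount,
      mul_sum]
    rw [sum_comm]
    exact sum_congr rfl fun j _ => sum_comm
  rw [expectation_sum_rounds_eq_feedbackMean, hcount]
  simp only [map_sum, map_smul, smul_eq_mul, historyKL]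

theorem historyKL_of_eq_off {i : Fin N} {k : Fin K}
    (h : ∀ i' k', i' ≠ i ∨ k' ≠ k → ν'.mean i' k' = ν.mean i' k') :
    historyKL ν ν' π T =
      bernoulliKL (ν.mean i k) (ν'.mean i k) * expectation ν π T (matchCount i k) := by
  rw [historyKL, Fintype.sum_eq_single i, Fintype.sum_eq_single k]
  · intro k' hk'
    rw [h i k' (Or.inr hk'), bernoulliKL_self, zero_mul]
  · intro i' hi'
    refine sum_eq_zero fun k' _ => ?_
    rw [h i' k' (Or.inl hi'), bernoulliKL_self, zero_mul]

theorem mul_exp_neg_historyKL_le (ν ν' : BernoulliInstance N K) (π : Policy N K) (T : ℕ)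
    (i : Fin N) (k : Fin K) :
    T * (Real.exp (-historyKL ν ν' π T) / 2) ≤
      expectation ν π T (matchCount i k) + (T - expectation ν' π T (matchCount i k)) := by
  have hbh := bretagnolle_huber (historyProb_nonneg ν π T) (sum_historyProb ν π T)
    (sum_historyProb ν' π T) (historyProb_eq_mul_exp ν ν' π)
    fun h => ⟨matchCount_nonneg i k h, matchCount_le i k h⟩
  rw [← expectation_sum_roundLLR]
  simpa only [expectation_apply, mul_sub, sum_sub_distrib, ← sum_mul, sum_historyProb, one_mul]
    using hbh

end LikelihoodRatio

section Regret

open Classical in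
/-- Regret of agent `j` in a round in which the agents choose the arms `a`. -/
noncomputable def roundRegret (ν : BernoulliInstance N K) (j : Fin N) (a : Fin N → Fin K) : ℝ :=
  ν.mean j (ν.stableArm j) - if Matched a j then ν.mean j (a j) else 0

theorem regret_eq_expectation_sum_roundRegret :
    regret ν π j T = expectation ν π T fun h => ∑ t, roundRegret ν j (h t).1 :=
  (expectation_apply _).symm

/-- Agent `i` likes arm `k` best, by the margin `g`. -/
def BernoulliInstance.IsBestArmBy (ν : BernoulliInstance N K) (g : ℝ) (i : Fin N) (k : Fin K) :
    Prop :=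
  ∀ l, l ≠ k → ν.mean i l + g ≤ ν.mean i k

variable {g : ℝ}

theorem mul_one_sub_matchedTo_le_roundRegret (h : ν.IsBestArmBy g j (ν.stableArm j))
    (a : Fin N → Fin K) : g * (1 - matchedTo j (ν.stableArm j) a) ≤ roundRegret ν j a := by
  unfold roundRegret matchedTo
  by_cases hm : Matched a j
  · by_cases ha : a j = ν.stableArm j
    · simp [hm, ha]
    · simpa [hm, ha] using le_sub_iff_add_le'.2 (h _ ha)
  · obtain ⟨i, hij, -⟩ : ∃ i < j, a i = a j := by simpa [Matched] using hm
    have hne : ν.stableArm i ≠ ν.stableArm j := ν.isStableMatching_stableArm.1.ne hij.ne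
    have hg : g ≤ ν.mean j (ν.stableArm j) := by
      linarith [h _ hne, ν.mean_pos j (ν.stableArm i)]
    simpa [hm] using hg

theorem mul_sub_expectation_matchCount_le_regret (h : ν.IsBestArmBy g j (ν.stableArm j)) :
    g * (T - expectation ν π T (matchCount j (ν.stableArm j))) ≤ regret ν π j T := by
  have hround : g • ((fun _ => (T : ℝ)) - matchCount j (ν.stableArm j)) ≤
      fun y : Fin T → Round N K => ∑ t, roundRegret ν j (y t).1 := fun y => by
    simpa [matchCount, mul_sub, mul_sum, mul_comm] using
      sum_le_sum fun t (_ : t ∈ univ) => mul_one_sub_matchedTo_le_roundRegret h (y t).1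
  simpa only [map_smul, map_sub, expectation_const, smul_eq_mul,
    ← regret_eq_expectation_sum_roundRegret] using expectation_mono (ν := ν) (π := π) hround

theorem mul_sum_arms_le_regret (hg : 0 ≤ g) (h : ν.IsBestArmBy g j (ν.stableArm j))
    {s : Finset (Fin K)} (hs : ν.stableArm j ∉ s) :
    g * ∑ l ∈ s, expectation ν π T (matchCount j l) ≤ regret ν π j T := by
  have hsum : ∑ l ∈ insert (ν.stableArm j) s, expectation ν π T (matchCount j l) ≤ T :=
    (sum_le_univ_sum_of_nonneg fun _ => expectation_matchCount_nonneg).trans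
      (sum_expectation_matchCount_le (sum_arms_matchedTo_le_one j))
  rw [sum_insert hs] at hsum
  exact (mul_le_mul_of_nonneg_left (by linarith) hg).trans
    (mul_sub_expectation_matchCount_le_regret h)

theorem mul_sum_agents_le_regret (hg : 0 ≤ g) (h : ν.IsBestArmBy g j (ν.stableArm j))
    {s : Finset (Fin N)} (hs : j ∉ s) :
    g * ∑ i ∈ s, expectation ν π T (matchCount i (ν.stableArm j)) ≤ regret ν π j T := by
  have hsum : ∑ i ∈ insert j s, expectation ν π T (matchCount i (ν.stableArm j)) ≤ T :=
    (sum_le_univ_sum_of_nonneg fun _ => expectation_matchCount_nonneg).trans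
      (sum_expectation_matchCount_le (sum_agents_matchedTo_le_one (ν.stableArm j)))
  rw [sum_insert hs] at hsum
  exact (mul_le_mul_of_nonneg_left (by linarith) hg).trans
    (mul_sub_expectation_matchCount_le_regret h)

theorem mul_exp_neg_historyKL_le_regret_add_regret (hg : 0 ≤ g)
    (hν : ν.IsBestArmBy g i (ν.stableArm i)) (hν' : ν'.IsBestArmBy g i (ν'.stableArm i))
    (hne : ν.stableArm i ≠ ν'.stableArm i) :
    g * (T * (Real.exp (-historyKL ν ν' π T) / 2)) ≤ regret ν π i T + regret ν' π i T := by
  have hcount : g * expectation ν π T (matchCount i (ν'.stableArm i)) ≤ regret ν π i T := by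
    simpa only [sum_singleton] using mul_sum_arms_le_regret hg hν (notMem_singleton.2 hne)
  calc g * (T * (Real.exp (-historyKL ν ν' π T) / 2))
      ≤ g * (expectation ν π T (matchCount i (ν'.stableArm i)) +
          (T - expectation ν' π T (matchCount i (ν'.stableArm i)))) :=
        mul_le_mul_of_nonneg_left (mul_exp_neg_historyKL_le ν ν' π T i _) hg
    _ ≤ _ := by
        rw [mul_add]
        exact add_le_add hcount (mul_sub_expectation_matchCount_le_regret hν')

end Regret

section Consistency

theorem BernoulliInstance.eventually_isBestArmBy
    (h : ∀ l, l ≠ k → ν.mean i l < ν.mean i k) : ∀ᶠ g in 𝓝[>] 0, ν.IsBestArmBy g i k := by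
  refine nhdsWithin_le_nhds (eventually_all.2 fun l => ?_)
  by_cases hl : l = k
  · exact Eventually.of_forall fun g hne => absurd hl hne
  · filter_upwards [eventually_le_nhds (sub_pos.2 (h l hl))] with g hg _
    linarith

variable {α : ℝ}

theorem UniformlyConsistent.eventually_regret_le (hπ : UniformlyConsistent π)
    (ν : BernoulliInstance N K) (j : Fin N) (hα : α ∈ Set.Ioo 0 1) :
    ∀ᶠ T : ℕ in atTop, regret ν π j T ≤ (T : ℝ) ^ α := by
  have hlt := (hπ ν j α hα.1 hα.2).trans_lt (EReal.coe_pos.2 one_pos)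
  filter_upwards [eventually_lt_of_limsup_lt hlt, eventually_gt_atTop 0] with T hT hT0
  have hpow : (0 : ℝ) < (T : ℝ) ^ α := Real.rpow_pos_of_pos (Nat.cast_pos.2 hT0) _
  exact ((div_lt_one hpow).1 (EReal.coe_lt_coe_iff.1 hT)).le

theorem UniformlyConsistent.eventually_log_le_historyKL (hπ : UniformlyConsistent π)
    (hν : ∀ l, l ≠ ν.stableArm i → ν.mean i l < ν.mean i (ν.stableArm i))
    (hν' : ∀ l, l ≠ ν'.stableArm i → ν'.mean i l < ν'.mean i (ν'.stableArm i))
    (hne : ν.stableArm i ≠ ν'.stableArm i) (hα : α ∈ Set.Ioo 0 1) :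
    ∀ᶠ T : ℕ in atTop, (1 - α) * Real.log T ≤ historyKL ν ν' π T := by
  obtain ⟨g, ⟨hg, hg'⟩, hg0 : 0 < g⟩ :=
    ((BernoulliInstance.eventually_isBestArmBy hν).and
      (BernoulliInstance.eventually_isBestArmBy hν') |>.and self_mem_nhdsWithin).exists
  have hα2 : α / 2 ∈ Set.Ioo 0 1 := ⟨half_pos hα.1, by linarith [hα.1, hα.2]⟩
  have hlarge : ∀ᶠ T : ℕ in atTop, 4 / g ≤ (T : ℝ) ^ (α / 2) :=
    ((tendsto_rpow_atTop hα2.1).comp tendsto_natCast_atTop_atTop).eventually_ge_atTop _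
  filter_upwards [hlarge, hπ.eventually_regret_le ν i hα2, hπ.eventually_regret_le ν' i hα2,
    eventually_gt_atTop 0] with T hT hR hR' hT0
  have hTpos : (0 : ℝ) < T := Nat.cast_pos.2 hT0
  have hexp : Real.exp (-historyKL ν ν' π T) ≤ (T : ℝ) ^ (α - 1) := by
    have htest := mul_exp_neg_historyKL_le_regret_add_regret (T := T) (π := π) hg0.le hg hg' hne
    calc Real.exp (-historyKL ν ν' π T) ≤ 4 / g * (T : ℝ) ^ (α / 2) / T := by
          rw [div_mul_eq_mul_div, div_div, le_div_iff₀ (by positivity)]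
          linarith
      _ ≤ (T : ℝ) ^ (α / 2) * (T : ℝ) ^ (α / 2) / T := by gcongr
      _ = (T : ℝ) ^ (α - 1) := by
          rw [← Real.rpow_add hTpos, add_halves, Real.rpow_sub_one hTpos.ne']
  have hlog := Real.log_le_log (Real.exp_pos _) hexp
  rw [Real.log_exp, Real.log_rpow hTpos] at hlog
  linarith

end Consistency

section UpdateMean

namespace BernoulliInstance

theorem stableArm_eq_of_isStableMatching {m : Fin N → Fin K} (h : ν.IsStableMatching m) :
    ν.stableArm = m :=
  ν.existsUnique_isStableMatching.unique ν.isStableMatching_stableArm h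

theorem stableArm_eq_of_forall_mean_le (hk : ∀ l, ν.mean i l ≤ ν.mean i k)
    (hfree : ∀ i' < i, ν.stableArm i' ≠ k) : ν.stableArm i = k := by
  refine ν.mean_injective i (le_antisymm (hk _) (not_lt.1 fun hlt => ?_))
  obtain ⟨i', hi', he⟩ := ν.isStableMatching_stableArm.2 i k hlt
  exact hfree i' hi' he

theorem stableArm_congr (h : ∀ i' ≤ i, ν.mean i' = ν'.mean i') :
    ν.stableArm i = ν'.stableArm i := by
  induction i using WellFoundedLT.induction with
  | _ i ih =>
    have hlower : ∀ i' < i, ν.stableArm i' = ν'.stableArm i' := fun i' hi' =>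
      ih i' hi' fun i'' hi'' => h i'' (hi''.trans hi'.le)
    have hi := h i le_rfl
    refine ν.mean_injective i (le_antisymm ?_ ?_) <;> refine not_lt.1 fun hlt => ?_
    · obtain ⟨i', hi', he⟩ := ν'.isStableMatching_stableArm.2 i (ν.stableArm i) (hi ▸ hlt)
      exact hi'.ne (ν.isStableMatching_stableArm.1 ((hlower i' hi').trans he))
    · obtain ⟨i', hi', he⟩ := ν.isStableMatching_stableArm.2 i (ν'.stableArm i) hlt
      exact hi'.ne (ν'.isStableMatching_stableArm.1 ((hlower i' hi').symm.trans he))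

/-- The instance in which the mean of arm `k` for agent `i` is replaced by `q`. -/
def updateMean (ν : BernoulliInstance N K) (i : Fin N) (k : Fin K) (q : ℝ)
    (hq : q ∈ Set.Ioo 0 1) (hne : ∀ l, l ≠ k → ν.mean i l ≠ q) : BernoulliInstance N K where
  mean := Function.update ν.mean i (Function.update (ν.mean i) k q)
  agents_le_arms := ν.agents_le_arms
  mean_pos :=
    (Function.forall_update_iff ν.mean fun _ f => ∀ l, 0 < f l).2
      ⟨(Function.forall_update_iff (ν.mean i) fun _ x => 0 < x).2
        ⟨hq.1, fun l _ => ν.mean_pos i l⟩, fun i' _ => ν.mean_pos i'⟩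
  mean_lt_one :=
    (Function.forall_update_iff ν.mean fun _ f => ∀ l, f l < 1).2
      ⟨(Function.forall_update_iff (ν.mean i) fun _ x => x < 1).2
        ⟨hq.2, fun l _ => ν.mean_lt_one i l⟩, fun i' _ => ν.mean_lt_one i'⟩
  mean_injective := by
    refine (Function.forall_update_iff ν.mean fun _ f => Function.Injective f).2
      ⟨fun l₁ l₂ h => ?_, fun i' _ => ν.mean_injective i'⟩
    by_cases h₁ : l₁ = k <;> by_cases h₂ : l₂ = k
    · rw [h₁, h₂]
    · simp only [h₁, Function.update_self, Function.update_of_ne h₂] at h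
      exact absurd h.symm (hne l₂ h₂)
    · simp only [h₂, Function.update_self, Function.update_of_ne h₁] at h
      exact absurd h (hne l₁ h₁)
    · rw [Function.update_of_ne h₁, Function.update_of_ne h₂] at h
      exact ν.mean_injective i h

variable {q : ℝ} {hq : q ∈ Set.Ioo 0 1} {hne : ∀ l, l ≠ k → ν.mean i l ≠ q}

theorem updateMean_mean_self : (ν.updateMean i k q hq hne).mean i k = q := by
  simp only [updateMean, Function.update_self]

theorem updateMean_mean_of_ne {i' : Fin N} {k' : Fin K} (h : i' ≠ i ∨ k' ≠ k) :
    (ν.updateMean i k q hq hne).mean i' k' = ν.mean i' k' := by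
  by_cases hi : i' = i
  · subst hi
    simp only [updateMean, Function.update_self, Function.update_of_ne (h.neg_resolve_left rfl)]
  · simp only [updateMean, Function.update_of_ne hi]

theorem stableArm_updateMean_of_lt {i' : Fin N} (hi' : i' < i) :
    (ν.updateMean i k q hq hne).stableArm i' = ν.stableArm i' :=
  stableArm_congr fun _ h => funext fun _ => updateMean_mean_of_ne (Or.inl (h.trans_lt hi').ne)

end BernoulliInstance

theorem UniformlyConsistent.eventually_log_le_mul_expectation_matchCount
    (hπ : UniformlyConsistent π)
    (hν : ∀ l, l ≠ ν.stableArm i → ν.mean i l < ν.mean i (ν.stableArm i))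
    (hk : ∀ i' ≤ i, ν.stableArm i' ≠ k) {q : ℝ} (hq : ν.mean i (ν.stableArm i) < q) (hq1 : q < 1)
    {α : ℝ} (hα : α ∈ Set.Ioo 0 1) :
    ∀ᶠ T : ℕ in atTop, (1 - α) * Real.log T ≤
      bernoulliKL (ν.mean i k) q * expectation ν π T (matchCount i k) := by
  have hlt : ∀ l, ν.mean i l < q := fun l => by
    rcases eq_or_ne l (ν.stableArm i) with rfl | hl
    exacts [hq, (hν l hl).trans hq]
  let ν' := ν.updateMean i k q ⟨(ν.mean_pos i k).trans (hlt k), hq1⟩ fun l _ => (hlt l).ne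
  have hself : ν'.mean i k = q := BernoulliInstance.updateMean_mean_self
  have hof_ne : ∀ i' k', i' ≠ i ∨ k' ≠ k → ν'.mean i' k' = ν.mean i' k' := fun _ _ =>
    BernoulliInstance.updateMean_mean_of_ne
  have hbest : ∀ l, l ≠ k → ν'.mean i l < ν'.mean i k := fun l hl => by
    rw [hof_ne i l (Or.inr hl), hself]
    exact hlt l
  have hstable : ν'.stableArm i = k := by
    refine BernoulliInstance.stableArm_eq_of_forall_mean_le (fun l => ?_) fun i' hi' => ?_
    · rcases eq_or_ne l k with rfl | hl
      exacts [le_rfl, (hbest l hl).le]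
    · exact (BernoulliInstance.stableArm_updateMean_of_lt hi').trans_ne (hk i' hi'.le)
  have hkl := hπ.eventually_log_le_historyKL hν (ν' := ν') (by rwa [hstable])
    (by rw [hstable]; exact hk i le_rfl) hα
  simpa only [historyKL_of_eq_off hof_ne, hself] using hkl

end UpdateMean

section DiagonalInstance

theorem rev_div_mem_Ico (l : Fin K) : ((l.rev : ℕ) / (2 * K) : ℝ) ∈ Set.Ico 0 (1 / 2) := by
  have hK : (0 : ℝ) < K := Nat.cast_pos.2 l.pos
  have hl : ((l.rev : ℕ) : ℝ) < K := Nat.cast_lt.2 l.rev.2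
  refine ⟨by positivity, ?_⟩
  rw [div_lt_iff₀ (by positivity)]
  linarith

theorem offDiagonalMean_mem_Ioo {d : ℝ} (hd : d ∈ Set.Ioc 0 (1 / 4)) (l : Fin K) :
    1 / 2 - d * (1 + (l.rev : ℕ) / (2 * K)) ∈ Set.Ioo 0 (1 / 2) := by
  obtain ⟨h0, h1⟩ := rev_div_mem_Ico l
  obtain ⟨hd0, hd1⟩ := hd
  constructor <;> nlinarith

/-- The instance in which each agent likes the arm of its own index best, and the gaps of agent `i`
lie between `d i` and `3 / 2 * d i`. To make the means distinct, the gaps decrease in the index of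
the arm, down to `d i` for the last arm. -/
noncomputable def diagonalInstance (hNK : N ≤ K) (d : Fin N → ℝ)
    (hd : ∀ i, d i ∈ Set.Ioc 0 (1 / 4)) : BernoulliInstance N K where
  mean i l := if l = Fin.castLE hNK i then 1 / 2 else 1 / 2 - d i * (1 + (l.rev : ℕ) / (2 * K))
  agents_le_arms := hNK
  mean_pos i l := by
    split_ifs
    exacts [one_half_pos, (offDiagonalMean_mem_Ioo (hd i) l).1]
  mean_lt_one i l := by
    split_ifs
    exacts [one_half_lt_one, (offDiagonalMean_mem_Ioo (hd i) l).2.trans one_half_lt_one]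
  mean_injective i l₁ l₂ h := by
    dsimp only at h
    split_ifs at h with h₁ h₂ h₂
    · rw [h₁, h₂]
    · exact absurd h.symm (offDiagonalMean_mem_Ioo (hd i) l₂).2.ne
    · exact absurd h (offDiagonalMean_mem_Ioo (hd i) l₁).2.ne
    · have hK : (2 * K : ℝ) ≠ 0 := by simp [l₁.pos.ne']
      have hrev : ((l₁.rev : ℕ) : ℝ) = (l₂.rev : ℕ) := by
        simpa [(hd i).1.ne', hK] using h
      exact Fin.rev_injective (Fin.ext (Nat.cast_injective hrev))

variable (hNK : N ≤ K) {d : Fin N → ℝ} (hd : ∀ i, d i ∈ Set.Ioc 0 (1 / 4)) {l : Fin K}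

theorem diagonalInstance_mean_self :
    (diagonalInstance hNK d hd).mean i (Fin.castLE hNK i) = 1 / 2 :=
  if_pos rfl

theorem diagonalInstance_mean_of_ne (hl : l ≠ Fin.castLE hNK i) :
    (diagonalInstance hNK d hd).mean i l = 1 / 2 - d i * (1 + (l.rev : ℕ) / (2 * K)) :=
  if_neg hl

theorem diagonalInstance_mean_le : (diagonalInstance hNK d hd).mean i l ≤ 1 / 2 := by
  by_cases hl : l = Fin.castLE hNK i
  · rw [hl, diagonalInstance_mean_self]
  · rw [diagonalInstance_mean_of_ne hNK hd hl]
    exact (offDiagonalMean_mem_Ioo (hd i) l).2.le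

theorem le_diagonalInstance_mean :
    1 / 2 - 3 / 2 * d i ≤ (diagonalInstance hNK d hd).mean i l := by
  have hdi := (hd i).1
  by_cases hl : l = Fin.castLE hNK i
  · rw [hl, diagonalInstance_mean_self]
    linarith
  · rw [diagonalInstance_mean_of_ne hNK hd hl]
    nlinarith [(rev_div_mem_Ico l).2]

theorem diagonalInstance_stableArm : (diagonalInstance hNK d hd).stableArm = Fin.castLE hNK := by
  refine BernoulliInstance.stableArm_eq_of_isStableMatching
    ⟨Fin.castLE_injective hNK, fun i l hlt => ?_⟩
  rw [diagonalInstance_mean_self] at hlt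
  exact absurd (diagonalInstance_mean_le hNK hd) hlt.not_ge

theorem diagonalInstance_isBestArmBy (i : Fin N) :
    (diagonalInstance hNK d hd).IsBestArmBy (d i) i
      ((diagonalInstance hNK d hd).stableArm i) := by
  intro l hl
  rw [diagonalInstance_stableArm] at hl ⊢
  rw [diagonalInstance_mean_self, diagonalInstance_mean_of_ne hNK hd hl]
  linarith [mul_nonneg (hd i).1.le (rev_div_mem_Ico l).1]

theorem diagonalInstance_isOSB : (diagonalInstance hNK d hd).IsOSB := fun i l hl => by
  linarith [diagonalInstance_isBestArmBy hNK hd i l hl, (hd i).1]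

theorem diagonalInstance_isMinGap (hi : (i : ℕ) + 1 < K) (hmin : ∀ i', d i ≤ d i') :
    (diagonalInstance hNK d hd).IsMinGap (d i) := by
  constructor
  · let last : Fin K := ⟨K - 1, by omega⟩
    have hlast : ∀ i' ≤ i, Fin.castLE hNK i' ≠ last := fun i' hi' => by
      refine Fin.ne_of_lt ?_
      simp only [Fin.lt_def, Fin.val_castLE, last]
      omega
    have hrev : (last.rev : ℕ) = 0 := by
      simp only [Fin.val_rev, last]
      omega
    refine ⟨i, last, by rwa [diagonalInstance_stableArm], ?_⟩
    rw [BernoulliInstance.gap, diagonalInstance_stableArm, diagonalInstance_mean_self,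
      diagonalInstance_mean_of_ne hNK hd (hlast i le_rfl).symm, hrev]
    simp
  · rintro δ ⟨i', l, hl, rfl⟩
    rw [BernoulliInstance.gap]
    linarith [diagonalInstance_isBestArmBy hNK hd i' l (hl i' le_rfl).symm, hmin i']

theorem bernoulliKL_diagonalInstance_le :
    bernoulliKL ((diagonalInstance hNK d hd).mean i l) (1 / 2 + d i / 2) ≤ 20 * d i ^ 2 := by
  obtain ⟨hd0, hd1⟩ := hd i
  have hsq : ((diagonalInstance hNK d hd).mean i l - (1 / 2 + d i / 2)) ^ 2 ≤ (2 * d i) ^ 2 :=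
    sq_le_sq' (by linarith [le_diagonalInstance_mean hNK hd (i := i) (l := l)])
      (by linarith [diagonalInstance_mean_le hNK hd (i := i) (l := l)])
  have hvar : 1 / 5 ≤ (1 / 2 + d i / 2) * (1 - (1 / 2 + d i / 2)) := by nlinarith
  calc _ ≤ ((diagonalInstance hNK d hd).mean i l - (1 / 2 + d i / 2)) ^ 2 /
          ((1 / 2 + d i / 2) * (1 - (1 / 2 + d i / 2))) :=
        bernoulliKL_le (BernoulliInstance.mean_mem_Ioo _ _ _) ⟨by linarith, by linarith⟩
    _ ≤ (2 * d i) ^ 2 / (1 / 5) := by gcongr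
    _ = 20 * d i ^ 2 := by ring

theorem UniformlyConsistent.eventually_log_div_le_expectation_matchCount_diagonalInstance
    (hπ : UniformlyConsistent π) (hl : Fin.castLE hNK i < l) :
    ∀ᶠ T : ℕ in atTop, Real.log T / (40 * d i ^ 2) ≤
      expectation (diagonalInstance hNK d hd) π T (matchCount i l) := by
  have hdi := (hd i).1
  have hl' : ∀ i' ≤ i, (diagonalInstance hNK d hd).stableArm i' ≠ l := fun i' hi' => by
    rw [diagonalInstance_stableArm]
    exact (lt_of_le_of_lt ((Fin.castLE_le_castLE_iff hNK).2 hi') hl).ne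
  have hq : (diagonalInstance hNK d hd).mean i ((diagonalInstance hNK d hd).stableArm i) <
      1 / 2 + d i / 2 := by
    rw [diagonalInstance_stableArm, diagonalInstance_mean_self]
    linarith
  filter_upwards [hπ.eventually_log_le_mul_expectation_matchCount (diagonalInstance_isOSB hNK hd i)
    hl' hq (by linarith [(hd i).2]) ⟨one_half_pos, one_half_lt_one⟩] with T hT
  have hkl := hT.trans (mul_le_mul_of_nonneg_right (bernoulliKL_diagonalInstance_le hNK hd)
    expectation_matchCount_nonneg)
  rw [div_le_iff₀ (by positivity)]
  linarith

theorem UniformlyConsistent.eventually_sum_agents_le_regret_diagonalInstance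
    (hπ : UniformlyConsistent π) (j : Fin N) :
    ∀ᶠ T : ℕ in atTop, d j * ∑ i ∈ Iio j, Real.log T / (40 * d i ^ 2) ≤
      regret (diagonalInstance hNK d hd) π j T := by
  have hcount := (eventually_all_finset (Iio j)).2 fun i hi =>
    hπ.eventually_log_div_le_expectation_matchCount_diagonalInstance hNK hd
      ((Fin.castLE_lt_castLE_iff hNK).2 (mem_Iio.1 hi))
  filter_upwards [hcount] with T hT
  have hreg := mul_sum_agents_le_regret (π := π) (T := T) (hd j).1.le
    (diagonalInstance_isBestArmBy hNK hd j) notMem_Iio_self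
  rw [diagonalInstance_stableArm] at hreg
  exact (mul_le_mul_of_nonneg_left (sum_le_sum hT) (hd j).1.le).trans hreg

theorem UniformlyConsistent.eventually_sum_arms_le_regret_diagonalInstance
    (hπ : UniformlyConsistent π) (j : Fin N) :
    ∀ᶠ T : ℕ in atTop, d j * ((K - 1 - j : ℕ) * (Real.log T / (40 * d j ^ 2))) ≤
      regret (diagonalInstance hNK d hd) π j T := by
  have hcount := (eventually_all_finset (Ioi (Fin.castLE hNK j))).2 fun l hl =>
    hπ.eventually_log_div_le_expectation_matchCount_diagonalInstance hNK hd (mem_Ioi.1 hl)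
  filter_upwards [hcount] with T hT
  have hsum := card_nsmul_le_sum _ _ _ hT
  rw [Fin.card_Ioi, Fin.val_castLE, nsmul_eq_mul] at hsum
  refine (mul_le_mul_of_nonneg_left hsum (hd j).1.le).trans ?_
  refine mul_sum_arms_le_regret (hd j).1.le (diagonalInstance_isBestArmBy hNK hd j) ?_
  rw [diagonalInstance_stableArm]
  exact notMem_Ioi_self

end DiagonalInstance

section HardInstances

variable {Δ : ℝ}

theorem exists_instance_log_div_sq_le_regret (hNK : N ≤ K) (hj : 0 < (j : ℕ))
    (hΔ : Δ ∈ Set.Ioc 0 (1 / 4)) :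
    ∃ ν : BernoulliInstance N K, ν.IsOSB ∧ ν.IsMinGap Δ ∧ ∀ π, UniformlyConsistent π →
      ∀ᶠ T : ℕ in atTop, 1 / 160 * ((j : ℕ) * Real.log T / Δ ^ 2) ≤ regret ν π j T := by
  let d : Fin N → ℝ := Function.update (fun _ => Δ) j (1 / 4)
  have hdj : d j = 1 / 4 := Function.update_self ..
  have hd_of_ne : ∀ i, i ≠ j → d i = Δ := fun i hi => Function.update_of_ne hi ..
  have hd : ∀ i, d i ∈ Set.Icc Δ (1 / 4) := fun i => by
    rcases eq_or_ne i j with rfl | hi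
    · rw [hdj]
      exact ⟨hΔ.2, le_rfl⟩
    · rw [hd_of_ne i hi]
      exact ⟨le_rfl, hΔ.2⟩
  have hfirst : d ⟨0, j.pos⟩ = Δ := hd_of_ne _ (Fin.ne_of_lt hj)
  have hd' : ∀ i, d i ∈ Set.Ioc 0 (1 / 4) := fun i => ⟨hΔ.1.trans_le (hd i).1, (hd i).2⟩
  have hgap : (diagonalInstance hNK d hd').IsMinGap (d ⟨0, j.pos⟩) :=
    diagonalInstance_isMinGap hNK hd' (by simp only; omega) fun i => hfirst.trans_le (hd i).1
  refine ⟨diagonalInstance hNK d hd', diagonalInstance_isOSB hNK hd', hfirst ▸ hgap,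
    fun π hπ => ?_⟩
  filter_upwards [hπ.eventually_sum_agents_le_regret_diagonalInstance hNK hd' j] with T hT
  have hsum : ∑ i ∈ Iio j, Real.log T / (40 * d i ^ 2) = j * (Real.log T / (40 * Δ ^ 2)) := by
    rw [sum_congr rfl fun i hi => by rw [hd_of_ne i (mem_Iio.1 hi).ne], sum_const, Fin.card_Iio,
      nsmul_eq_mul]
  calc 1 / 160 * ((j : ℕ) * Real.log T / Δ ^ 2) = 1 / 4 * (j * (Real.log T / (40 * Δ ^ 2))) := by
        ring
    _ ≤ _ := by rwa [hdj, hsum] at hT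

theorem exists_instance_log_div_le_regret (hNK : N ≤ K) (hK : 2 ≤ K) (hj : (j : ℕ) ≤ (K / 4 : ℝ))
    (hΔ : Δ ∈ Set.Ioc 0 (1 / 4)) :
    ∃ ν : BernoulliInstance N K, ν.IsOSB ∧ ν.IsMinGap Δ ∧ ∀ π, UniformlyConsistent π →
      ∀ᶠ T : ℕ in atTop, 1 / 160 * (K * Real.log T / Δ) ≤ regret ν π j T := by
  refine ⟨diagonalInstance hNK (fun _ => Δ) fun _ => hΔ, diagonalInstance_isOSB hNK _,
    diagonalInstance_isMinGap hNK _ (i := ⟨0, j.pos⟩) hK fun _ => le_rfl, fun π hπ => ?_⟩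
  have hcard : (K / 4 : ℝ) ≤ (K - 1 - j : ℕ) := by
    have hjK : 1 + (j : ℕ) ≤ K := by omega
    have hK' : (2 : ℝ) ≤ K := Nat.ofNat_le_cast.2 hK
    rw [Nat.sub_sub, Nat.cast_sub hjK]
    push_cast
    linarith
  filter_upwards [hπ.eventually_sum_arms_le_regret_diagonalInstance hNK (fun _ => hΔ) j] with T hT
  have hΔ0 := hΔ.1
  calc 1 / 160 * (K * Real.log T / Δ) = Δ * (K / 4 * (Real.log T / (40 * Δ ^ 2))) := by
        field_simp
        ring
    _ ≤ Δ * ((K - 1 - j : ℕ) * (Real.log T / (40 * Δ ^ 2))) := by gcongr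
    _ ≤ _ := hT

end HardInstances

end SerialDictatorship

theorem corollary2 :
    ∃ c : ℝ, 0 < c ∧
      ∀ (N K : ℕ), 2 ≤ K → N ≤ K → ∀ (j : Fin N) (Δ : ℝ), 0 < Δ → Δ ≤ 1 / 4 →
        ∃ ν : SerialDictatorship.BernoulliInstance N K, ν.IsOSB ∧ ν.IsMinGap Δ ∧
          ∀ π : SerialDictatorship.Policy N K, SerialDictatorship.UniformlyConsistent π →
            ∀ᶠ T : ℕ in Filter.atTop,
              c * max ((j : ℕ) * Real.log T / Δ ^ 2) (K * Real.log T / Δ) ≤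
                SerialDictatorship.regret ν π j T := by
  refine ⟨1 / 160, by norm_num, fun N K hK hNK j Δ hΔ hΔ4 => ?_⟩
  have hKpos : (0 : ℝ) < K := Nat.cast_pos.2 (by omega)
  have hdiv : ∀ T : ℕ, K * Real.log T / Δ = K * Δ * Real.log T / Δ ^ 2 := fun T => by
    field_simp
  rcases le_total (K * Δ) (j : ℕ) with hj | hj
  · have hj0 : 0 < (j : ℕ) := Nat.cast_pos.1 ((mul_pos hKpos hΔ).trans_le hj)
    obtain ⟨ν, hosb, hgap, hν⟩ :=
      SerialDictatorship.exists_instance_log_div_sq_le_regret hNK hj0 ⟨hΔ, hΔ4⟩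
    refine ⟨ν, hosb, hgap, fun π hπ => (hν π hπ).mono fun T hT => ?_⟩
    rwa [max_eq_left (hdiv T ▸ by gcongr)]
  · obtain ⟨ν, hosb, hgap, hν⟩ :=
      SerialDictatorship.exists_instance_log_div_le_regret (j := j) hNK hK (by nlinarith) ⟨hΔ, hΔ4⟩
    refine ⟨ν, hosb, hgap, fun π hπ => (hν π hπ).mono fun T hT => ?_⟩
    rwa [max_eq_right (hdiv T ▸ by gcongr)]
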